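/- Let $S$ be a complete separable metric space with its Borel $\sigma$-algebra, let $M_1(S)$ be the space of probability measures on $S$ with the $\sigma$-algebra generated by the evaluations $\nu\mapsto\nu(B)$, $B\subseteq S$ Borel, and define $M_1(M_1(S))$ likewise. Let $\xi=\{\xi_{ij}: i,j\in\mathbb N\}$ be an array of $S$-valued random variables on a probability space $(\Omega,\mathcal F,P)$. Assume that $\xi$ is row exchangeable: for all finite permutations $\sigma$ and $\tau_1,\tau_2,\ldots$ of $\mathbb N$, the arrays $\{\xi_{\sigma(i),\tau_i(j)}\}$ and $\{\xi_{ij}\}$ have the same finite-dimensional distributions. Call random probability measures $\mu_1,\mu_2,\ldots$ on $S$, together with a random probability measure $\varpi$ on $M_1(S)$, row distributions and a row distribution generator of $\xi$ if the conditional law of $(\mu_i)_{i\in\mathbb N}$ given $\varpi$ is $\varpi^\infty$ and, for each $i$, the conditional law of $(\xi_{ij})_{j\in\mathbb N}$ given $\mu_i$ is $\mu_i^\infty$. Here the conditional law of $X$ given $Y$ is $\nu$ if $P(X\in A\mid Y)=\nu(A)$ a.s. for every measurable $A$. Then row distributions and a row distribution generator of $\xi$ exist, and for any such $\mu_1,\mu_2,\ldots$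 and $\varpi$, writing $\mathbf X_{mn}=(\xi_{ij})_{i\le m,\,j\le n}$ and $\boldsymbol\mu_m=(\mu_1,\ldots,\mu_m)$, the regular conditional distributions satisfy \[ \mathcal L(\mathbf X_{mn}\mid\varpi,\boldsymbol\mu_m)=\mathcal L(\mathbf X_{mn}\mid\boldsymbol\mu_m)=\prod_{i=1}^m\mu_i^n\quad\text{a.s., for all } m,n\in\mathbb N . \] -/

import Mathlib

open MeasureTheory ProbabilityTheory

/-- A finite permutation of `ℕ`: a bijection that moves only finitely many elements. -/
def IsFinitePerm (σ : Equiv.Perm ℕ) : Prop :=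
  {i | σ i ≠ i}.Finite

/-- The array `ξ i j` is row exchangeable under `P`: for all finite permutations `σ` (of the rows)
and `τ i` (of the entries within row `i`, a separate one for each row), the arrays
`ξ (σ i) (τ i j)` and `ξ i j` have the same finite-dimensional distributions. -/
def RowExchangeable {Ω S : Type*} [MeasurableSpace Ω] [MeasurableSpace S]
    (ξ : ℕ → ℕ → Ω → S) (P : Measure Ω) : Prop :=
  ∀ (σ : Equiv.Perm ℕ) (τ : ℕ → Equiv.Perm ℕ), IsFinitePerm σ → (∀ i, IsFinitePerm (τ i)) →
    ∀ I : Finset (ℕ × ℕ),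
      P.map (fun ω (p : I) => ξ (σ p.1.1) (τ p.1.1 p.1.2) ω) =
        P.map (fun ω (p : I) => ξ p.1.1 p.1.2 ω)

/-- `ν` is the conditional law of `X` given `Y`: `P(X ∈ A ∣ σ(Y)) = ν(A)` almost surely, for every
measurable set `A`. -/
def HasCondLaw {Ω E T : Type*} [MeasurableSpace Ω] [MeasurableSpace E] [mT : MeasurableSpace T]
    (X : Ω → E) (Y : Ω → T) (ν : Ω → Measure E) (P : Measure Ω) : Prop :=
  ∀ A : Set E, MeasurableSet A →
    P⟦X ⁻¹' A | mT.comap Y⟧ =ᵐ[P] fun ω => (ν ω).real A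

/-- `μ 0, μ 1, …` are row distributions of the array `ξ`, with row distribution generator `ϖ`:
given `ϖ`, the sequence `μ` is i.i.d. with law `ϖ`, and for each `i`, given `μ i`, the `i`-th row
of `ξ` is i.i.d. with law `μ i`. The space of probability measures carries the `σ`-algebra
generated by the evaluations `ν ↦ ν B`. -/
structure IsRowDirecting {Ω S : Type*} [MeasurableSpace Ω] [MeasurableSpace S]
    (ξ : ℕ → ℕ → Ω → S) (μ : ℕ → Ω → ProbabilityMeasure S)
    (ϖ : Ω → ProbabilityMeasure (ProbabilityMeasure S)) (P : Measure Ω) : Prop where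
  measurable_row : ∀ i, Measurable (μ i)
  measurable_generator : Measurable ϖ
  rows_given_generator :
    HasCondLaw (fun ω (i : ℕ) => μ i ω) ϖ
      (fun ω => Measure.infinitePi fun _ : ℕ => (ϖ ω : Measure (ProbabilityMeasure S))) P
  entries_given_row : ∀ i,
    HasCondLaw (fun ω (j : ℕ) => ξ i j ω) (μ i)
      (fun ω => Measure.infinitePi fun _ : ℕ => (μ i ω : Measure S)) P

/-- The first `m` terms of a sequence of random elements, as one random vector. -/
def firstTerms {Ω T : Type*} (μ : ℕ → Ω → T) (m : ℕ) (ω : Ω) : Fin m → T :=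
  fun i => μ i ω

/-- The upper left `m × n` block of the array `ξ`. -/
def block {Ω S : Type*} (ξ : ℕ → ℕ → Ω → S) (m n : ℕ) (ω : Ω) : Fin m → Fin n → S :=
  fun i j => ξ i j ω

theorem inner_average_average {H : Type*} [NormedAddCommGroup H] [InnerProductSpace ℝ H]
    (v : ℕ → H) (a b : ℝ) (hd : ∀ i, inner ℝ (v i) (v i) = a)
    (ho : ∀ i j, i ≠ j → inner ℝ (v i) (v j) = b) {N M : ℕ} (hN : 0 < N) (hNM : N ≤ M) :
    inner ℝ ((N : ℝ)⁻¹ • ∑ k ∈ Finset.range N, v k) ((M : ℝ)⁻¹ • ∑ k ∈ Finset.range M, v k)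
      = b + (a - b) * (M : ℝ)⁻¹ := by
  have h1 : ∀ i ∈ Finset.range N, ∑ j ∈ Finset.range M, inner ℝ (v i) (v j) = M * b + (a - b) := by
    intro i hi
    have : ∀ j ∈ Finset.range M, inner ℝ (v i) (v j) = b + if i = j then a - b else 0 := by
      intro j _
      split_ifs with h
      · subst h; rw [hd]; ring
      · rw [ho i j h]; ring
    rw [Finset.sum_congr rfl this, Finset.sum_add_distrib, Finset.sum_ite_eq, if_pos]
    · simp
    · simp only [Finset.mem_range] at hi ⊢; omega
  have hN' : (N : ℝ) ≠ 0 := by positivity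
  have hM' : (M : ℝ) ≠ 0 := by have : 0 < M := by omega
                               positivity
  rw [real_inner_smul_left, real_inner_smul_right, sum_inner]
  simp_rw [inner_sum]
  rw [Finset.sum_congr rfl h1]
  simp only [Finset.sum_const, Finset.card_range, nsmul_eq_mul]
  field_simp

open Filter Topology in
theorem cauchySeq_average {H : Type*} [NormedAddCommGroup H] [InnerProductSpace ℝ H]
    (v : ℕ → H) (a b : ℝ) (hd : ∀ i, inner ℝ (v i) (v i) = a)
    (ho : ∀ i j, i ≠ j → inner ℝ (v i) (v j) = b) :
    CauchySeq fun N : ℕ => (N : ℝ)⁻¹ • ∑ k ∈ Finset.range N, v k := by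
  set S : ℕ → H := fun N : ℕ => (N : ℝ)⁻¹ • ∑ k ∈ Finset.range N, v k
  have key : ∀ N M : ℕ, 0 < N → N ≤ M → ‖S N - S M‖ ^ 2 ≤ |a - b| * (N : ℝ)⁻¹ := by
    intro N M hN hNM
    rw [norm_sub_sq_real, ← real_inner_self_eq_norm_sq, ← real_inner_self_eq_norm_sq,
      inner_average_average v a b hd ho hN le_rfl,
      inner_average_average v a b hd ho (hN.trans_le hNM) le_rfl,
      inner_average_average v a b hd ho hN hNM]
    have h1 : (0 : ℝ) ≤ (N : ℝ)⁻¹ - (M : ℝ)⁻¹ := by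
      rw [sub_nonneg]; gcongr
    have h2 : (0 : ℝ) ≤ (M : ℝ)⁻¹ := by positivity
    have h3 := le_abs_self (a - b)
    have h4 := abs_nonneg (a - b)
    nlinarith [mul_le_mul_of_nonneg_right h3 h1, mul_nonneg h4 h2]
  have hlim : Tendsto (fun N : ℕ => Real.sqrt (|a - b| * (N : ℝ)⁻¹)) atTop (𝓝 0) := by
    have := ((tendsto_inv_atTop_nhds_zero_nat (𝕜 := ℝ)).const_mul |a - b|).sqrt
    simpa using this
  refine (cauchySeq_shift 1).1 (cauchySeq_of_le_tendsto_0' _ ?_ ((tendsto_add_atTop_iff_nat 1).2 hlim))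
  intro N M hNM
  rw [dist_eq_norm]
  exact Real.le_sqrt_of_sq_le (key (N + 1) (M + 1) (by omega) (by omega))

open Filter Topology in
theorem tendsto_average_of_inner {H : Type*} [NormedAddCommGroup H] [InnerProductSpace ℝ H]
    (v : ℕ → H) (z : H) (a b : ℝ) (hd : ∀ i, inner ℝ (v i) (v i) = a)
    (ho : ∀ i j, i ≠ j → inner ℝ (v i) (v j) = b) (hz : ∀ i, inner ℝ (v i) z = b)
    (hzz : inner ℝ z z = b) :
    Tendsto (fun N : ℕ => (N : ℝ)⁻¹ • ∑ k ∈ Finset.range N, v k) atTop (𝓝 z) := by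
  rw [tendsto_iff_norm_sub_tendsto_zero]
  have hlim : Tendsto (fun N : ℕ => Real.sqrt ((a - b) * (N : ℝ)⁻¹)) atTop (𝓝 0) := by
    have := ((tendsto_inv_atTop_nhds_zero_nat (𝕜 := ℝ)).const_mul (a - b)).sqrt
    simpa using this
  refine hlim.congr' ?_
  filter_upwards [eventually_gt_atTop 0] with N hN
  symm
  rw [← Real.sqrt_sq (norm_nonneg _)]
  congr 1
  rw [norm_sub_sq_real, ← real_inner_self_eq_norm_sq, ← real_inner_self_eq_norm_sq, hzz,
    inner_average_average v a b hd ho hN le_rfl, real_inner_smul_left, sum_inner,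
    Finset.sum_congr rfl (fun i _ => hz i)]
  have : (N : ℝ) ≠ 0 := by positivity
  simp only [Finset.sum_const, Finset.card_range, nsmul_eq_mul]
  field_simp
  ring

/-- The relative frequency of the events `s 0, …, s (N - 1)`. -/
noncomputable def freq {Ω : Type*} (s : ℕ → Set Ω) (N : ℕ) (ω : Ω) : ℝ :=
  (N : ℝ)⁻¹ * ∑ k ∈ Finset.range N, (s k).indicator (fun _ => (1 : ℝ)) ω

theorem measurable_freq {Ω : Type*} [MeasurableSpace Ω] {s : ℕ → Set Ω}
    (hs : ∀ k, MeasurableSet (s k)) (N : ℕ) : Measurable (freq s N) := by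
  unfold freq
  exact (Finset.measurable_sum _ fun k _ => measurable_const.indicator (hs k)).const_mul _

section
variable {Ω : Type*} [MeasurableSpace Ω] {P : Measure Ω} [IsProbabilityMeasure P]
  {s : ℕ → Set Ω}

theorem coeFn_average_indicatorConstLp (hs : ∀ k, MeasurableSet (s k)) (N : ℕ) :
    ((N : ℝ)⁻¹ • ∑ k ∈ Finset.range N,
      indicatorConstLp 2 (hs k) (measure_ne_top P _) (1 : ℝ) : Lp ℝ 2 P) =ᵐ[P] freq s N := by
  filter_upwards [Lp.coeFn_smul (N : ℝ)⁻¹ (∑ k ∈ Finset.range N,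
      indicatorConstLp 2 (hs k) (measure_ne_top P _) (1 : ℝ)),
    Lp.coeFn_finsetSum (p := 2) (μ := P) (Finset.range N)
      (fun k => indicatorConstLp 2 (hs k) (measure_ne_top P _) (1 : ℝ)),
    ae_all_iff.2 fun k => indicatorConstLp_coeFn (p := 2) (hs := hs k)
      (hμs := measure_ne_top P _) (c := (1 : ℝ))] with ω h1 h2 h3
  rw [h1, Pi.smul_apply, h2]
  simp only [Finset.sum_apply, h3, freq, smul_eq_mul]

open Filter Topology in
theorem tendsto_eLpNorm_freq_of_tendsto_Lp (hs : ∀ k, MeasurableSet (s k)) {z : Ω → ℝ}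
    (hz : MemLp z 2 P) (h : Tendsto (fun N : ℕ => (N : ℝ)⁻¹ • ∑ k ∈ Finset.range N,
      indicatorConstLp 2 (hs k) (measure_ne_top P _) (1 : ℝ)) atTop (𝓝 (hz.toLp z))) :
    Tendsto (fun N => eLpNorm (freq s N - z) 1 P) atTop (𝓝 0) := by
  rw [Lp.tendsto_Lp_iff_tendsto_eLpNorm'] at h
  refine tendsto_of_tendsto_of_tendsto_of_le_of_le tendsto_const_nhds h (fun _ => bot_le) ?_
  intro N
  refine (eLpNorm_le_eLpNorm_of_exponent_le one_le_two
    ((measurable_freq hs N).aestronglyMeasurable.sub hz.1)).trans (le_of_eq ?_)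
  exact eLpNorm_congr_ae ((coeFn_average_indicatorConstLp hs N).symm.sub hz.coeFn_toLp.symm)

open Filter Topology in
/-- The frequencies of events with constant first and second order probabilities converge. -/
theorem exists_tendsto_eLpNorm_freq (hs : ∀ k, MeasurableSet (s k)) {a b : ℝ}
    (ha : ∀ k, P.real (s k) = a) (hb : ∀ j k, j ≠ k → P.real (s j ∩ s k) = b) :
    ∃ W : Ω → ℝ, Measurable W ∧ Integrable W P ∧
      Tendsto (fun N => eLpNorm (freq s N - W) 1 P) atTop (𝓝 0) := by
  obtain ⟨W, hW⟩ := cauchySeq_tendsto_of_complete (cauchySeq_average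
    (fun k => indicatorConstLp 2 (hs k) (measure_ne_top P _) (1 : ℝ)) a b
    (fun i => by rw [L2.real_inner_indicatorConstLp_one_indicatorConstLp_one, Set.inter_self, ha])
    (fun i j h => by rw [L2.real_inner_indicatorConstLp_one_indicatorConstLp_one, hb i j h]))
  rw [← Lp.toLp_coeFn W (Lp.memLp W)] at hW
  exact ⟨W, (Lp.stronglyMeasurable W).measurable, (Lp.memLp W).integrable one_le_two,
    tendsto_eLpNorm_freq_of_tendsto_Lp hs _ hW⟩

open Filter Topology in
theorem tendsto_eLpNorm_freq (hs : ∀ k, MeasurableSet (s k)) {a b : ℝ}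
    (ha : ∀ k, P.real (s k) = a) (hb : ∀ j k, j ≠ k → P.real (s j ∩ s k) = b)
    {z : Ω → ℝ} (hz : MemLp z 2 P) (hsz : ∀ k, ∫ ω in s k, z ω ∂P = b)
    (hzz : ∫ ω, z ω * z ω ∂P = b) :
    Tendsto (fun N => eLpNorm (freq s N - z) 1 P) atTop (𝓝 0) := by
  refine tendsto_eLpNorm_freq_of_tendsto_Lp hs hz (tendsto_average_of_inner
    (fun k => indicatorConstLp 2 (hs k) (measure_ne_top P _) (1 : ℝ)) (hz.toLp z) a b
    (fun i => ?_) (fun i j h => ?_) (fun i => ?_) ?_)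
  · rw [L2.real_inner_indicatorConstLp_one_indicatorConstLp_one, Set.inter_self, ha]
  · rw [L2.real_inner_indicatorConstLp_one_indicatorConstLp_one, hb i j h]
  · rw [L2.inner_indicatorConstLp_one, ← hsz i]
    exact setIntegral_congr_ae (hs i) (hz.coeFn_toLp.mono fun _ h _ => h)
  · rw [L2.inner_def, ← hzz]
    refine integral_congr_ae (hz.coeFn_toLp.mono fun ω h => ?_)
    simp [h, sq]
end

theorem freq_preimage {Ω Ω' : Type*} (s : ℕ → Set Ω) (f : Ω' → Ω) (N : ℕ) (ω : Ω') :
    freq (fun k => f ⁻¹' s k) N ω = freq s N (f ω) := by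
  simp only [freq]
  congr 1

theorem freq_reindex {Ω : Type*} (s : ℕ → Set Ω) (σ : Equiv.Perm ℕ) {N : ℕ} (hσ : ∀ k, N ≤ k → σ k = k) :
    freq (fun k => s (σ k)) N = freq s N := by
  ext ω
  simp only [freq]
  congr 1
  exact Equiv.Perm.sum_comp σ (Finset.range N) (fun k => (s k).indicator (fun _ => (1 : ℝ)) ω)
    fun k hk => by
      by_contra h
      exact hk (hσ k (by simpa using h))

theorem measurable_limsup_freq {Ω : Type*} [MeasurableSpace Ω] {s : ℕ → Set Ω}
    (hs : ∀ k, MeasurableSet (s k)) (ns : ℕ → ℕ) :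
    Measurable fun ω => Filter.limsup (fun n => freq s (ns n) ω) Filter.atTop :=
  Measurable.limsup fun n => measurable_freq hs (ns n)

open Filter Topology in
theorem exists_subseq_tendsto_freq {Ω : Type*} [MeasurableSpace Ω] {P : Measure Ω}
    {s : ℕ → Set Ω} (hs : ∀ k, MeasurableSet (s k)) {W : Ω → ℝ}
    (hW : Measurable W) (h : Tendsto (fun N => eLpNorm (freq s N - W) 1 P) atTop (𝓝 0)) :
    ∃ ns : ℕ → ℕ, StrictMono ns ∧
      W =ᵐ[P] fun ω => limsup (fun n => freq s (ns n) ω) atTop := by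
  obtain ⟨ns, hns, hlim⟩ := (tendstoInMeasure_of_tendsto_eLpNorm one_ne_zero
    (fun N => (measurable_freq hs N).aestronglyMeasurable) hW.aestronglyMeasurable
    h).exists_seq_tendsto_ae
  exact ⟨ns, hns, hlim.mono fun ω hω => hω.limsup_eq.symm⟩

section
variable {Ω T ι : Type*} [mΩ : MeasurableSpace Ω] [MeasurableSpace T] [DecidableEq ι]

/-- The events that are almost surely determined by the array `X` in a way that is invariant under
exchanging two entries of the same row. -/
abbrev symmetricEvents (X : Ω → ι × ℕ → T) (P : Measure Ω) : MeasurableSpace Ω where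
  MeasurableSet' A := MeasurableSet A ∧ ∃ D : Set (ι × ℕ → T), MeasurableSet D ∧
    (∀ i j k, (fun x => x ∘ Equiv.swap (i, j) (i, k)) ⁻¹' D = D) ∧ A =ᵐ[P] X ⁻¹' D
  measurableSet_empty := ⟨.empty, ∅, .empty, by simp, by simp⟩
  measurableSet_compl := by
    rintro A ⟨hA, D, hD, hinv, hAD⟩
    exact ⟨hA.compl, Dᶜ, hD.compl, fun i j k => by rw [Set.preimage_compl, hinv], hAD.compl⟩
  measurableSet_iUnion := by
    intro A h
    choose hA D hD hinv hAD using h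
    refine ⟨.iUnion hA, ⋃ n, D n, .iUnion hD, fun i j k => ?_, ?_⟩
    · simp only [Set.preimage_iUnion, hinv]
    · rw [Set.preimage_iUnion]
      exact Filter.EventuallyEq.countable_iUnion hAD

/-- The law of the array `X` is invariant under exchanging two entries of the same row. -/
def RowSwapInvariant (X : Ω → ι × ℕ → T) (P : Measure Ω) : Prop :=
  ∀ i j k, P.map (fun ω => X ω ∘ Equiv.swap (i, j) (i, k)) = P.map X

variable {X : Ω → ι × ℕ → T} {P : Measure Ω}

theorem symmetricEvents_le : symmetricEvents X P ≤ mΩ := fun _ h => h.1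

theorem measurable_symmetricEvents_of_ae_eq {U : Type*} [MeasurableSpace U] {W W' : Ω → U}
    (hW : Measurable W) (hW' : Measurable[symmetricEvents X P] W') (h : W =ᵐ[P] W') :
    Measurable[symmetricEvents X P] W := by
  intro D hD
  obtain ⟨-, E, hE, hinv, hWE⟩ := hW' hD
  exact ⟨hW hD, E, hE, hinv, (h.preimage D).trans hWE⟩

theorem measurable_symmetricEvents_comp {U : Type*} [MeasurableSpace U] (hX : Measurable X)
    {h : (ι × ℕ → T) → U} (hh : Measurable h)
    (hinv : ∀ i j k x, h (x ∘ Equiv.swap (i, j) (i, k)) = h x) :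
    Measurable[symmetricEvents X P] fun ω => h (X ω) := by
  intro D hD
  refine ⟨(hh.comp hX) hD, h ⁻¹' D, hh hD, fun i j k => ?_, .rfl⟩
  ext x
  simp [hinv]

open Filter Topology in
theorem measurable_symmetricEvents_of_tendsto_freq {s : ℕ → Set Ω}
    (hs : ∀ k, MeasurableSet[symmetricEvents X P] (s k)) {W : Ω → ℝ} (hW : Measurable W)
    (h : Tendsto (fun N => eLpNorm (freq s N - W) 1 P) atTop (𝓝 0)) :
    Measurable[symmetricEvents X P] W := by
  obtain ⟨ns, -, hns⟩ := exists_subseq_tendsto_freq (fun k => (hs k).1) hW h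
  refine measurable_symmetricEvents_of_ae_eq hW ?_ hns
  exact @measurable_limsup_freq _ (symmetricEvents X P) _ hs ns

open Filter Topology in
/-- Limits of frequencies along a row are symmetric. -/
theorem measurable_symmetricEvents_of_tendsto_freq_row (hX : Measurable X) (i : ι) {B : Set T}
    (hB : MeasurableSet B) {W : Ω → ℝ} (hW : Measurable W)
    (h : Tendsto (fun N => eLpNorm (freq (fun k => {ω | X ω (i, k) ∈ B}) N - W) 1 P) atTop (𝓝 0)) :
    Measurable[symmetricEvents X P] W := by
  have hs : ∀ k, MeasurableSet {x : ι × ℕ → T | x (i, k) ∈ B} :=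
    fun k => measurable_pi_apply (i, k) hB
  obtain ⟨ns, hmono, hns⟩ := exists_subseq_tendsto_freq (fun k => hX (hs k)) hW h
  refine measurable_symmetricEvents_of_ae_eq hW ?_ hns
  have key := measurable_symmetricEvents_comp (P := P) hX
    (h := fun x => limsup (fun n => freq (fun k => {x : ι × ℕ → T | x (i, k) ∈ B}) (ns n) x) atTop)
    (measurable_limsup_freq hs ns) ?_
  · simp only [← freq_preimage _ X] at key
    exact key
  · intro i' j k x
    refine limsup_congr ?_
    filter_upwards [hmono.tendsto_atTop.eventually_gt_atTop (max j k)] with n hn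
    rw [← freq_preimage _ (fun x : ι × ℕ → T => x ∘ Equiv.swap (i', j) (i', k))]
    by_cases hi : i' = i
    · subst hi
      rw [← freq_reindex (fun k => {x : ι × ℕ → T | x (i', k) ∈ B}) (Equiv.swap j k)
        (fun l hl => Equiv.swap_apply_of_ne_of_ne (by omega) (by omega))]
      congr 2 with l y
      have : Equiv.swap (i', j) (i', k) (i', l) = (i', Equiv.swap j k l) := by
        simp only [Equiv.swap_apply_def, Prod.mk.injEq, true_and]
        split_ifs <;> rfl
      simp [this]
    · congr 2 with l y
      have : Equiv.swap (i', j) (i', k) (i, l) = (i, l) :=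
        Equiv.swap_apply_of_ne_of_ne (by simp [Ne.symm hi]) (by simp [Ne.symm hi])
      simp [this]

theorem measureReal_inter_preimage_swap (hX : Measurable X) (hinv : RowSwapInvariant X P)
    (i : ι) (j k : ℕ) {A : Set Ω} (hA : MeasurableSet[symmetricEvents X P] A)
    {C : Set (ι × ℕ → T)} (hC : MeasurableSet C) :
    P.real ((fun ω => X ω ∘ Equiv.swap (i, j) (i, k)) ⁻¹' C ∩ A) = P.real (X ⁻¹' C ∩ A) := by
  obtain ⟨-, D, hD, hDinv, hAD⟩ := hA
  have hsw : Measurable fun x : ι × ℕ → T => x ∘ Equiv.swap (i, j) (i, k) := by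
    unfold Function.comp; fun_prop
  have h1 : ((fun ω => X ω ∘ Equiv.swap (i, j) (i, k)) ⁻¹' C ∩ A : Set Ω) =ᵐ[P]
      ((fun ω => X ω ∘ Equiv.swap (i, j) (i, k)) ⁻¹' (C ∩ D) : Set Ω) := by
    refine (Filter.EventuallyEq.rfl.inter hAD).trans (Filter.EventuallyEq.of_eq ?_)
    conv_lhs => rw [← hDinv i j k]
    rfl
  have h2 : (X ⁻¹' C ∩ A : Set Ω) =ᵐ[P] (X ⁻¹' (C ∩ D) : Set Ω) :=
    (Filter.EventuallyEq.rfl.inter hAD).trans (Filter.EventuallyEq.of_eq rfl)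
  rw [measureReal_congr h1, measureReal_congr h2, measureReal_def, measureReal_def,
    ← Measure.map_apply hX (hC.inter hD), ← hinv i j k,
    Measure.map_apply (show Measurable fun ω => X ω ∘ Equiv.swap (i, j) (i, k) from hsw.comp hX)
      (hC.inter hD)]

variable [IsProbabilityMeasure P]

theorem condExp_preimage_swap (hX : Measurable X) (hinv : RowSwapInvariant X P)
    (i : ι) (j k : ℕ) {C : Set (ι × ℕ → T)} (hC : MeasurableSet C) :
    P⟦(fun ω => X ω ∘ Equiv.swap (i, j) (i, k)) ⁻¹' C | symmetricEvents X P⟧ =ᵐ[P]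
      P⟦X ⁻¹' C | symmetricEvents X P⟧ := by
  have hsw : Measurable fun x : ι × ℕ → T => x ∘ Equiv.swap (i, j) (i, k) := by
    unfold Function.comp; fun_prop
  have hC' : MeasurableSet ((fun ω => X ω ∘ Equiv.swap (i, j) (i, k)) ⁻¹' C) := (hsw.comp hX) hC
  refine ae_eq_condExp_of_forall_setIntegral_eq symmetricEvents_le
    ((integrable_const _).indicator (hX hC)) (fun _ _ _ => integrable_condExp.integrableOn)
    (fun A hA _ => ?_) stronglyMeasurable_condExp.aestronglyMeasurable
  rw [setIntegral_condExp symmetricEvents_le ((integrable_const _).indicator hC') hA,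
    integral_indicator_const _ hC', integral_indicator_const _ (hX hC),
    measureReal_restrict_apply hC', measureReal_restrict_apply (hX hC),
    measureReal_inter_preimage_swap hX hinv i j k hA hC]

open Filter Topology in
/-- Given the symmetric events, the entries of the array are independent, with conditional
probabilities given by the limits of frequencies along the rows. -/
theorem condExp_iInter_preimage (hX : Measurable X) (hinv : RowSwapInvariant X P)
    {B : ι × ℕ → Set T} (hB : ∀ p, MeasurableSet (B p)) {Z : ι × ℕ → Ω → ℝ}
    (hZm : ∀ p, Measurable[symmetricEvents X P] (Z p)) (hZ : ∀ p, Integrable (Z p) P)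
    (hlim : ∀ p, Tendsto (fun N => eLpNorm
      (freq (fun k => {ω | X ω (p.1, k) ∈ B p}) N - Z p) 1 P) atTop (𝓝 0))
    (F : Finset (ι × ℕ)) :
    P⟦X ⁻¹' (F : Set (ι × ℕ)).pi B | symmetricEvents X P⟧ =ᵐ[P] fun ω => ∏ p ∈ F, Z p ω := by
  classical
  induction F using Finset.induction_on with
  | empty =>
    simp only [Finset.coe_empty, Set.empty_pi, Set.preimage_univ, Set.indicator_univ,
      Finset.prod_empty]
    rw [condExp_const symmetricEvents_le]
  | insert p F hp ih =>
    obtain ⟨i, j⟩ := p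
    set R : Set Ω := X ⁻¹' (F : Set (ι × ℕ)).pi B with hRdef
    have hFm : MeasurableSet ((F : Set (ι × ℕ)).pi B) := .pi F.countable_toSet fun p _ => hB p
    have hR : MeasurableSet R := hX hFm
    set s : ℕ → Set Ω := fun k => {ω | X ω (i, k) ∈ B (i, j)} with hsdef
    have hev : ∀ k, MeasurableSet {x : ι × ℕ → T | x (i, k) ∈ B (i, j)} :=
      fun k => measurable_pi_apply (i, k) (hB (i, j))
    have hs : ∀ k, MeasurableSet (s k) := fun k => hX (hev k)
    set f : ℕ → Ω → ℝ := fun k => P⟦s k ∩ R | symmetricEvents X P⟧ with hf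
    have hins : X ⁻¹' ((insert (i, j) F : Finset (ι × ℕ)) : Set (ι × ℕ)).pi B = s j ∩ R := by
      rw [Finset.coe_insert, Set.insert_pi]
      rfl
    rw [hins]
    have hconst : ∀ k, (i, k) ∉ F → f k =ᵐ[P] f j := by
      intro k hk
      have h := condExp_preimage_swap hX hinv i j k
        ((hev j).inter hFm)
      refine EventuallyEq.trans (EventuallyEq.of_eq ?_) h
      simp only [hf]
      congr 2
      ext ω
      simp only [Set.mem_inter_iff, Set.mem_preimage, hsdef, hRdef, Set.mem_ofPred_eq,
        Function.comp_apply, Equiv.swap_apply_left, Set.mem_pi]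
      refine and_congr_right fun _ => forall₂_congr fun q hq => ?_
      rw [Equiv.swap_apply_of_ne_of_ne]
      · rintro rfl; exact hp hq
      · rintro rfl; exact hk hq
    have hcofinite : ∀ᶠ k in atTop, (i, k) ∉ F := by
      have : (F.image Prod.snd : Set ℕ).Finite := Finset.finite_toSet _
      rw [← Nat.cofinite_eq_atTop]
      filter_upwards [this.compl_mem_cofinite] with k hk hk'
      exact hk (by simpa using ⟨i, hk'⟩)
    have hlim1 : ∀ᵐ ω ∂P, Tendsto (fun N : ℕ => (N : ℝ)⁻¹ * ∑ k ∈ Finset.range N, f k ω) atTop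
        (𝓝 (f j ω)) := by
      have : ∀ᵐ ω ∂P, ∀ k, (i, k) ∉ F → f k ω = f j ω :=
        ae_all_iff.2 fun k => by
          by_cases hk : (i, k) ∈ F
          · simp [hk]
          · exact (hconst k hk).mono fun ω h _ => h
      filter_upwards [this] with ω hω
      refine Tendsto.cesaro (tendsto_const_nhds.congr' ?_)
      filter_upwards [hcofinite] with k hk
      exact (hω k hk).symm
    set g : ℕ → Ω → ℝ := fun N => freq s N * R.indicator fun _ => 1 with hg
    have hint : ∀ k, Integrable ((s k ∩ R).indicator fun _ => (1 : ℝ)) P :=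
      fun k => (integrable_const _).indicator ((hs k).inter hR)
    have hgsum : ∀ N, g N = (N : ℝ)⁻¹ • ∑ k ∈ Finset.range N,
        (s k ∩ R).indicator fun _ => (1 : ℝ) := by
      intro N
      ext ω
      simp only [hg, freq, Pi.mul_apply, Pi.smul_apply, Finset.sum_apply, smul_eq_mul, mul_assoc,
        Finset.sum_mul, Set.indicator_apply, Set.mem_inter_iff, ite_and]
      congr 1
      refine Finset.sum_congr rfl fun k _ => ?_
      split_ifs <;> simp
    have hgint : ∀ N, Integrable (g N) P := fun N => by
      rw [hgsum]; exact (integrable_finsetSum' _ fun k _ => hint k).smul _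
    have hgcond : ∀ N, P[g N | symmetricEvents X P] =ᵐ[P]
        fun ω => (N : ℝ)⁻¹ * ∑ k ∈ Finset.range N, f k ω := by
      intro N
      rw [hgsum]
      filter_upwards [condExp_smul (μ := P) (N : ℝ)⁻¹ (∑ k ∈ Finset.range N,
        (s k ∩ R).indicator fun _ => (1 : ℝ)) (symmetricEvents X P),
        condExp_finsetSum (μ := P) (s := Finset.range N) (fun k _ => hint k)
          (symmetricEvents X P)] with ω h1 h2
      rw [h1, Pi.smul_apply, h2, Finset.sum_apply, smul_eq_mul]
    have hZR : Integrable (Z (i, j) * R.indicator fun _ => 1) P := by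
      refine (hZ (i, j)).mul_bdd (c := 1) ?_ ?_
      · exact (measurable_const.indicator hR).aestronglyMeasurable
      · refine Eventually.of_forall fun ω => ?_
        rw [Set.indicator_apply]; split_ifs <;> simp
    have hlim2 : TendstoInMeasure P (fun N => P[g N | symmetricEvents X P]) atTop
        (P[Z (i, j) * R.indicator fun _ => 1 | symmetricEvents X P]) := by
      refine tendstoInMeasure_of_tendsto_eLpNorm one_ne_zero
        (fun N => integrable_condExp.aestronglyMeasurable)
        integrable_condExp.aestronglyMeasurable ?_
      refine tendsto_of_tendsto_of_tendsto_of_le_of_le tendsto_const_nhds (hlim (i, j))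
        (fun _ => bot_le) fun N => ?_
      calc _ = eLpNorm (P[g N - Z (i, j) * R.indicator fun _ => 1 | symmetricEvents X P]) 1 P :=
            eLpNorm_congr_ae (condExp_sub (hgint N) hZR _).symm
        _ ≤ eLpNorm (g N - Z (i, j) * R.indicator fun _ => 1) 1 P :=
            eLpNorm_condExp_le_eLpNorm _ le_rfl
        _ ≤ _ := by
            refine eLpNorm_mono fun ω => ?_
            simp only [hg, Pi.sub_apply, Pi.mul_apply, Set.indicator_apply]
            split_ifs <;> simp [hsdef]
    have hlim3 : TendstoInMeasure P (fun N => P[g N | symmetricEvents X P]) atTop (f j) := by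
      refine tendstoInMeasure_of_tendsto_ae
        (fun N => integrable_condExp.aestronglyMeasurable) ?_
      filter_upwards [hlim1, ae_all_iff.2 hgcond] with ω h1 h2
      exact h1.congr fun N => (h2 N).symm
    refine (tendstoInMeasure_ae_unique hlim3 hlim2).trans ?_
    refine (condExp_mul_of_stronglyMeasurable_left (hZm (i, j)).stronglyMeasurable hZR
      ((integrable_const _).indicator hR)).trans ?_
    filter_upwards [ih] with ω hω
    rw [Pi.mul_apply, hω, Finset.prod_insert hp]

open Filter Topology in
/-- The frequencies along a row converge to the conditional probability given the symmetric
events. -/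
theorem tendsto_eLpNorm_freq_condExp (hX : Measurable X) (hinv : RowSwapInvariant X P) (i : ι)
    {B : Set T} (hB : MeasurableSet B) :
    Tendsto (fun N => eLpNorm (freq (fun k => {ω | X ω (i, k) ∈ B}) N -
      P⟦{ω | X ω (i, 0) ∈ B} | symmetricEvents X P⟧) 1 P) atTop (𝓝 0) := by
  set s : ℕ → Set Ω := fun k => {ω | X ω (i, k) ∈ B} with hsdef
  have hev : ∀ k, MeasurableSet {x : ι × ℕ → T | x (i, k) ∈ B} :=
    fun k => measurable_pi_apply (i, k) hB
  have hs : ∀ k, MeasurableSet (s k) := fun k => hX (hev k)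
  have hswap : ∀ j k l : ℕ, Equiv.swap (i, j) (i, k) (i, l) = (i, Equiv.swap j k l) := by
    intro j k l
    simp only [Equiv.swap_apply_def, Prod.mk.injEq, true_and]
    split_ifs <;> rfl
  have hpair : ∀ j k l m, P.real (s (Equiv.swap j k l) ∩ s (Equiv.swap j k m)) =
      P.real (s l ∩ s m) := by
    intro j k l m
    have := measureReal_inter_preimage_swap hX hinv i j k
      (@MeasurableSet.univ _ (symmetricEvents X P)) ((hev l).inter (hev m))
    simp only [Set.inter_univ] at this
    rw [Set.preimage_inter, Set.preimage_inter] at this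
    refine Eq.trans ?_ this
    congr 2 <;> ext ω <;> simp [hsdef, hswap]
  have ha : ∀ k, P.real (s k) = P.real (s 0) := by
    intro k
    have := hpair 0 k 0 0
    simpa using this
  have hb : ∀ j k, j ≠ k → P.real (s j ∩ s k) = P.real (s 0 ∩ s 1) := by
    intro j k hjk
    have h1 := hpair 0 j 0 (Equiv.swap 0 j k)
    have hk : Equiv.swap 0 j k ≠ 0 := by
      intro h
      rw [Equiv.swap_apply_eq_iff, Equiv.swap_apply_left] at h
      exact hjk h.symm
    have h2 := hpair 1 (Equiv.swap 0 j k) 0 1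
    rw [Equiv.swap_apply_left, Equiv.swap_apply_of_ne_of_ne zero_ne_one hk.symm] at h2
    rw [Equiv.swap_apply_left, Equiv.swap_apply_self] at h1
    rw [h1, h2]
  obtain ⟨W, hWm, hWi, hW⟩ := exists_tendsto_eLpNorm_freq hs ha hb
  have hWs : StronglyMeasurable[symmetricEvents X P] W :=
    (measurable_symmetricEvents_of_tendsto_freq_row hX i hB hWm hW).stronglyMeasurable
  have hint : ∀ k, Integrable ((s k).indicator fun _ => (1 : ℝ)) P :=
    fun k => (integrable_const _).indicator (hs k)
  have hcond : ∀ k, P⟦s k | symmetricEvents X P⟧ =ᵐ[P] P⟦s 0 | symmetricEvents X P⟧ := by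
    intro k
    refine EventuallyEq.trans (EventuallyEq.of_eq ?_)
      (condExp_preimage_swap hX hinv i 0 k (hev 0))
    congr 2
    ext ω
    simp [hsdef]
  have hfreq : ∀ N, freq s N = (N : ℝ)⁻¹ • ∑ k ∈ Finset.range N, (s k).indicator fun _ => (1 : ℝ) := by
    intro N; ext ω; simp [freq]
  have hfint : ∀ N, Integrable (freq s N) P := fun N => by
    rw [hfreq]; exact (integrable_finsetSum' _ fun k _ => hint k).smul _
  have hfcond : ∀ N, 0 < N →
      P[freq s N | symmetricEvents X P] =ᵐ[P] P⟦s 0 | symmetricEvents X P⟧ := by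
    intro N hN
    rw [hfreq]
    filter_upwards [condExp_smul (μ := P) (N : ℝ)⁻¹ (∑ k ∈ Finset.range N,
      (s k).indicator fun _ => (1 : ℝ)) (symmetricEvents X P),
      condExp_finsetSum (μ := P) (s := Finset.range N) (fun k _ => hint k)
        (symmetricEvents X P), ae_all_iff.2 hcond] with ω h1 h2 h3
    rw [h1, Pi.smul_apply, h2, Finset.sum_apply, Finset.sum_congr rfl fun k _ => h3 k]
    have : (N : ℝ) ≠ 0 := by positivity
    simp [this]
  have hle : ∀ N, 0 < N → eLpNorm (P⟦s 0 | symmetricEvents X P⟧ - W) 1 P ≤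
      eLpNorm (freq s N - W) 1 P := by
    intro N hN
    refine le_trans (le_of_eq (eLpNorm_congr_ae ?_))
      (eLpNorm_condExp_le_eLpNorm (m := symmetricEvents X P) (freq s N - W) le_rfl)
    refine EventuallyEq.trans ?_ (condExp_sub (hfint N) hWi _).symm
    rw [condExp_of_stronglyMeasurable symmetricEvents_le hWs hWi]
    exact (hfcond N hN).symm.sub .rfl
  have hzero : eLpNorm (P⟦s 0 | symmetricEvents X P⟧ - W) 1 P = 0 :=
    le_antisymm (ge_of_tendsto hW ((eventually_gt_atTop 0).mono hle)) bot_le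
  rw [eLpNorm_eq_zero_iff (integrable_condExp.sub hWi).aestronglyMeasurable one_ne_zero] at hzero
  refine hW.congr fun N => eLpNorm_congr_ae (EventuallyEq.rfl.sub ?_)
  filter_upwards [hzero] with ω hω
  exact (sub_eq_zero.1 hω).symm
end

section
variable {Ω U E T : Type*} [mΩ : MeasurableSpace Ω] [MeasurableSpace U] [mE : MeasurableSpace E]
  [MeasurableSpace T] {P : Measure Ω} [IsProbabilityMeasure P]

/-- The joint law of `(Y, V)` is determined by conditional probabilities of the events `V ∈ A`, for
`A` in a π-system, given a σ-algebra for which `Y` is measurable. -/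
theorem map_prodMk_eq_compProd_of_condExp {Ω : Type*} {m mΩ : MeasurableSpace Ω} {P : Measure Ω}
    [IsProbabilityMeasure P] (hm : m ≤ mΩ) {Y : Ω → U}
    (hY : Measurable[m] Y) {V : Ω → E} (hV : Measurable V) (κ : Kernel U E) [IsMarkovKernel κ]
    {C : Set (Set E)} (hgen : mE = .generateFrom C) (hpi : IsPiSystem C)
    (h : ∀ A ∈ C, P⟦V ⁻¹' A | m⟧ =ᵐ[P] fun ω => (κ (Y ω)).real A) :
    P.map (fun ω => (Y ω, V ω)) = P.map Y ⊗ₘ κ := by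
  have hY' : Measurable Y := hY.mono hm le_rfl
  have := Measure.isProbabilityMeasure_map (μ := P) hY'.aemeasurable
  have := Measure.isProbabilityMeasure_map (μ := P) (hY'.prodMk hV).aemeasurable
  refine Measure.ext_prod fun {D A} hD hA => ?_
  have hL : ∀ A, MeasurableSet A → P.map (fun ω => (Y ω, V ω)) (D ×ˢ A) =
      (P.restrict (Y ⁻¹' D)).map V A := by
    intro A hA
    rw [Measure.map_apply (hY'.prodMk hV) (hD.prod hA), Measure.map_apply hV hA,
      Measure.restrict_apply (hV hA), Set.inter_comm]
    rfl
  have hR : ∀ A, MeasurableSet A → (P.map Y ⊗ₘ κ) (D ×ˢ A) =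
      ((P.restrict (Y ⁻¹' D)).map Y).bind κ A := by
    intro A hA
    rw [Measure.compProd_apply_prod hD hA, Measure.bind_apply hA κ.aemeasurable,
      Measure.restrict_map hY' hD]
  rw [hL A hA, hR A hA]
  congr 1
  refine ext_of_generate_finite C hgen hpi (fun A hAC => ?_) ?_
  · have hA : MeasurableSet A := by rw [hgen]; exact .basic A hAC
    have h1 : ∫ ω in Y ⁻¹' D, (κ (Y ω)).real A ∂P = P.real (V ⁻¹' A ∩ Y ⁻¹' D) := by
      rw [← setIntegral_congr_ae (hY' hD) ((h A hAC).mono fun ω h _ => h),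
        setIntegral_condExp hm ((integrable_const _).indicator (hV hA)) (hY hD),
        integral_indicator_const _ (hV hA), measureReal_restrict_apply (hV hA)]
      simp
    have h2 : Measurable fun u => κ u A := κ.measurable_coe hA
    rw [Measure.map_apply hV hA, Measure.restrict_apply (hV hA),
      Measure.bind_apply hA κ.aemeasurable, lintegral_map h2 hY',
      ← ofReal_measureReal (measure_ne_top _ _), ← h1, ofReal_integral_eq_lintegral_ofReal]
    · exact lintegral_congr fun ω => ofReal_measureReal (measure_ne_top _ _)
    · refine Integrable.of_bound (C := 1) ?_ ?_
      · exact (h2.comp hY').ennreal_toReal.aestronglyMeasurable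
      · refine Filter.Eventually.of_forall fun ω => ?_
        rw [Real.norm_of_nonneg measureReal_nonneg]
        exact measureReal_le_one
    · exact Filter.Eventually.of_forall fun ω => measureReal_nonneg
  · rw [Measure.map_apply hV .univ, Measure.bind_apply .univ κ.aemeasurable]
    simp [Measure.map_apply hY' .univ]

theorem hasCondLaw_of_map_prodMk_eq_compProd {Y : Ω → U} (hY : Measurable Y) {V : Ω → E}
    (hV : Measurable V) (κ : Kernel U E) [IsMarkovKernel κ]
    (h : P.map (fun ω => (Y ω, V ω)) = P.map Y ⊗ₘ κ) :
    HasCondLaw V Y (fun ω => κ (Y ω)) P := by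
  intro A hA
  symm
  have h2 : Measurable fun u => κ u A := κ.measurable_coe hA
  have hint : Integrable (fun ω => (κ (Y ω)).real A) P := by
    refine Integrable.of_bound (C := 1) (h2.comp hY).ennreal_toReal.aestronglyMeasurable ?_
    refine Filter.Eventually.of_forall fun ω => ?_
    rw [Real.norm_of_nonneg measureReal_nonneg]
    exact measureReal_le_one
  refine ae_eq_condExp_of_forall_setIntegral_eq hY.comap_le
    ((integrable_const _).indicator (hV hA)) (fun _ _ _ => hint.integrableOn) ?_ ?_
  · rintro _ ⟨D, hD, rfl⟩ -
    rw [integral_indicator_const _ (hV hA), measureReal_restrict_apply (hV hA), smul_eq_mul,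
      mul_one]
    have h3 : P (V ⁻¹' A ∩ Y ⁻¹' D) = ∫⁻ ω in Y ⁻¹' D, κ (Y ω) A ∂P := by
      have := congrArg (fun ν => ν (D ×ˢ A)) h
      rw [Measure.compProd_apply_prod hD hA, Measure.map_apply (hY.prodMk hV) (hD.prod hA),
        setLIntegral_map hD h2 hY] at this
      rw [← this, Set.inter_comm]
      rfl
    rw [measureReal_def, h3, ← integral_toReal (f := fun ω => κ (Y ω) A) (h2.comp hY).aemeasurable
      (Filter.Eventually.of_forall fun ω => measure_lt_top _ _)]
    rfl
  · exact (h2.comp (comap_measurable Y)).ennreal_toReal.aestronglyMeasurable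

theorem measurable_infinitePi_probabilityMeasure :
    Measurable fun ν : ProbabilityMeasure T => Measure.infinitePi fun _ : ℕ => (ν : Measure T) := by
  refine Measurable.measure_of_isPiSystem_of_isProbabilityMeasure
    generateFrom_squareCylinders.symm
    (isPiSystem_squareCylinders (fun _ => MeasurableSpace.isPiSystem_measurableSet)
      fun _ => .univ) ?_
  rintro _ ⟨s, t, ht, rfl⟩
  simp only [Set.mem_pi, Set.mem_univ, forall_const, Set.mem_ofPred_eq] at ht
  simp_rw [Measure.infinitePi_pi _ fun i _ => ht i]
  exact Finset.measurable_prod _ fun i _ =>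
    (Measure.measurable_coe (ht i)).comp measurable_subtype_coe

variable (T) in
/-- The law of an i.i.d. sequence, as a kernel. -/
noncomputable def iidKernel : Kernel (ProbabilityMeasure T) (ℕ → T) :=
  ⟨fun ν => Measure.infinitePi fun _ => (ν : Measure T), measurable_infinitePi_probabilityMeasure⟩

theorem iidKernel_apply (ν : ProbabilityMeasure T) :
    iidKernel T ν = Measure.infinitePi fun _ => (ν : Measure T) := rfl

instance : IsMarkovKernel (iidKernel T) := ⟨fun ν => by rw [iidKernel_apply]; infer_instance⟩

/-- De Finetti's theorem, with the directing random measure as a function of the sequence. -/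
theorem exists_directing_measure [StandardBorelSpace T] [Nonempty T] (Q : Measure (ℕ → T))
    [IsProbabilityMeasure Q] (hQ : ∀ j k, Q.map (fun x => x ∘ Equiv.swap j k) = Q) :
    ∃ G : (ℕ → T) → ProbabilityMeasure T, Measurable G ∧
      Q.map (fun x => (G x, x)) = Q.map G ⊗ₘ iidKernel T := by
  set X : (ℕ → T) → Unit × ℕ → T := fun x p => x p.2 with hXdef
  have hX : Measurable X := by fun_prop
  have hinv : RowSwapInvariant X Q := by
    intro u j k
    have : (fun x => X x ∘ Equiv.swap (u, j) (u, k)) = X ∘ fun x => x ∘ Equiv.swap j k := by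
      ext x ⟨v, l⟩
      simp only [hXdef, Function.comp_apply, Equiv.swap_apply_def, Prod.mk.injEq, true_and]
      split_ifs <;> rfl
    have hsw : Measurable fun x : ℕ → T => x ∘ Equiv.swap j k := by unfold Function.comp; fun_prop
    rw [this, ← Measure.map_map hX hsw, hQ]
  have hle : symmetricEvents X Q ≤ MeasurableSpace.pi := symmetricEvents_le
  have hid : @Measurable _ _ MeasurableSpace.pi (symmetricEvents X Q) (id : (ℕ → T) → (ℕ → T)) := measurable_id'' hle
  let κ := @condDistrib _ _ _ _ _ _ MeasurableSpace.pi (symmetricEvents X Q) (fun x : ℕ → T => x 0) id Q _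
  let G : (ℕ → T) → ProbabilityMeasure T := fun x => ⟨κ x, inferInstance⟩
  have hG : Measurable[symmetricEvents X Q] G := Measurable.subtype_mk κ.measurable
  have hGB : ∀ B, MeasurableSet B → (fun x => (G x : Measure T).real B) =ᵐ[Q]
      Q⟦{x | X x ((), 0) ∈ B} | symmetricEvents X Q⟧ := by
    intro B hB
    have := condDistrib_ae_eq_condExp (mβ := symmetricEvents X Q) (μ := Q)
      (Y := fun x : ℕ → T => x 0) hid (measurable_pi_apply 0) hB
    rw [MeasurableSpace.comap_id] at this
    exact this
  refine ⟨G, hG.mono hle le_rfl, ?_⟩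
  refine map_prodMk_eq_compProd_of_condExp hle hG measurable_id (iidKernel T)
    generateFrom_squareCylinders.symm
    (isPiSystem_squareCylinders (fun _ => MeasurableSpace.isPiSystem_measurableSet)
      fun _ => .univ) ?_
  rintro _ ⟨s, t, ht, rfl⟩
  simp only [Set.mem_pi, Set.mem_univ, forall_const, Set.mem_ofPred_eq] at ht
  have hZm : ∀ k, Measurable[symmetricEvents X Q] fun x => (G x : Measure T).real (t k) := fun k =>
    ((Measure.measurable_coe (ht k)).comp (measurable_subtype_coe.comp hG)).ennreal_toReal
  have key := condExp_iInter_preimage hX hinv (B := fun p => t p.2) (fun p => ht p.2)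
    (Z := fun p x => (G x : Measure T).real (t p.2)) (fun p => hZm p.2)
    (fun p => integrable_condExp.congr (hGB _ (ht p.2)).symm)
    (fun p => (tendsto_eLpNorm_freq_condExp hX hinv p.1 (ht p.2)).congr fun N =>
      eLpNorm_congr_ae (Filter.EventuallyEq.rfl.sub (hGB _ (ht p.2)).symm))
    (s.map ⟨fun k => ((), k), fun _ _ h => (Prod.mk.inj h).2⟩)
  convert key using 2 with x
  · congr 1
    ext x
    simp [hXdef]
    exact Iff.rfl
  · rw [iidKernel_apply, measureReal_def, Measure.infinitePi_pi _ fun i _ => ht i,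
      ENNReal.toReal_prod, Finset.prod_map]
    rfl

/-- Images of the conditioning variable and of the conditioned variable. -/
theorem map_prodMk_eq_compProd_comp {U' E' : Type*} [MeasurableSpace U'] [MeasurableSpace E']
    {Y : Ω → U} (hY : Measurable Y) {V : Ω → E} (hV : Measurable V) {κ : Kernel U E}
    [IsMarkovKernel κ] (h : P.map (fun ω => (Y ω, V ω)) = P.map Y ⊗ₘ κ)
    {f : U → U'} (hf : Measurable f) {g : E → E'} (hg : Measurable g) {η : Kernel U' E'}
    [IsMarkovKernel η] (hη : ∀ u, η (f u) = (κ u).map g) :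
    P.map (fun ω => (f (Y ω), g (V ω))) = P.map (fun ω => f (Y ω)) ⊗ₘ η := by
  have hfY : Measurable fun ω => f (Y ω) := hf.comp hY
  have hgV : Measurable fun ω => g (V ω) := hg.comp hV
  have := Measure.isProbabilityMeasure_map (μ := P) hY.aemeasurable
  have := Measure.isProbabilityMeasure_map (μ := P) hfY.aemeasurable
  have := Measure.isProbabilityMeasure_map (μ := P) (hfY.prodMk (hgV)).aemeasurable
  refine Measure.ext_prod fun {D A} hD hA => ?_
  have h1 := congrArg (fun ν => ν ((f ⁻¹' D) ×ˢ (g ⁻¹' A))) h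
  beta_reduce at h1
  rw [Measure.compProd_apply_prod (hf hD) (hg hA), Measure.map_apply (hY.prodMk hV)
    ((hf hD).prod (hg hA))] at h1
  rw [Measure.compProd_apply_prod hD hA, Measure.map_apply (hfY.prodMk (hgV)) (hD.prod hA),
    show (fun ω => f (Y ω)) = f ∘ Y from rfl, ← Measure.map_map hf hY,
    setLIntegral_map hD (η.measurable_coe hA) hf]
  simp_rw [hη, Measure.map_apply hg hA]
  exact h1
end

theorem isFinitePerm_one : IsFinitePerm 1 := by simp [IsFinitePerm]

theorem isFinitePerm_swap (j k : ℕ) : IsFinitePerm (Equiv.swap j k) := by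
  refine (Set.toFinite {j, k}).subset fun l hl => ?_
  by_contra h
  simp only [Set.mem_insert_iff, Set.mem_singleton_iff, not_or] at h
  exact hl (Equiv.swap_apply_of_ne_of_ne h.1 h.2)

theorem swap_prodMk_apply {ι : Type*} [DecidableEq ι] (i i' : ι) (j k l : ℕ) :
    Equiv.swap (i, j) (i, k) (i', l) = (i', if i' = i then Equiv.swap j k l else l) := by
  simp only [Equiv.swap_apply_def, Prod.mk.injEq]
  split_ifs <;> simp_all

section
variable {Ω S T : Type*} [mΩ : MeasurableSpace Ω] {P : Measure Ω}
  [MeasurableSpace S] [MeasurableSpace T]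

theorem RowExchangeable.map_eq [IsProbabilityMeasure P]
    {ξ : ℕ → ℕ → Ω → S} (hex : RowExchangeable ξ P)
    (hξ : ∀ i j, Measurable (ξ i j)) {σ : Equiv.Perm ℕ} {τ : ℕ → Equiv.Perm ℕ}
    (hσ : IsFinitePerm σ) (hτ : ∀ i, IsFinitePerm (τ i)) :
    P.map (fun ω (p : ℕ × ℕ) => ξ (σ p.1) (τ p.1 p.2) ω) =
      P.map fun ω (p : ℕ × ℕ) => ξ p.1 p.2 ω := by
  have h1 : Measurable fun ω (p : ℕ × ℕ) => ξ (σ p.1) (τ p.1 p.2) ω :=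
    measurable_pi_lambda _ fun p => hξ _ _
  have h2 : Measurable fun ω (p : ℕ × ℕ) => ξ p.1 p.2 ω :=
    measurable_pi_lambda _ fun p => hξ _ _
  refine IsProjectiveLimit.unique
    (P := fun I : Finset (ℕ × ℕ) => P.map fun ω (p : I) => ξ p.1.1 p.1.2 ω) (fun I => ?_)
    (fun I => ?_)
  · rw [Measure.map_map (Finset.measurable_restrict I) h1]
    exact hex σ τ hσ hτ I
  · rw [Measure.map_map (Finset.measurable_restrict I) h2]
    rfl

theorem RowExchangeable.rowSwapInvariant [IsProbabilityMeasure P]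
    {ξ : ℕ → ℕ → Ω → S} (hex : RowExchangeable ξ P)
    (hξ : ∀ i j, Measurable (ξ i j)) :
    RowSwapInvariant (fun ω (p : ℕ × ℕ) => ξ p.1 p.2 ω) P := by
  intro i j k
  rw [← hex.map_eq hξ isFinitePerm_one (τ := Function.update (fun _ => 1) i (Equiv.swap j k))
    fun i' => ?_]
  · congr 1
    ext ω ⟨i', l⟩
    simp only [Function.comp_apply, swap_prodMk_apply, Function.update_apply]
    split_ifs <;> rfl
  · rw [Function.update_apply]
    split_ifs
    exacts [isFinitePerm_swap j k, isFinitePerm_one]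

theorem RowExchangeable.map_row_comp_swap [IsProbabilityMeasure P]
    {ξ : ℕ → ℕ → Ω → S} (hex : RowExchangeable ξ P)
    (hξ : ∀ i j, Measurable (ξ i j)) (i j k : ℕ) :
    (P.map fun ω l => ξ i l ω).map (fun x => x ∘ Equiv.swap j k) = P.map fun ω l => ξ i l ω := by
  have h := hex.map_eq hξ isFinitePerm_one fun _ => isFinitePerm_swap j k
  have hrow : Measurable fun (x : ℕ × ℕ → S) (l : ℕ) => x (i, l) := by fun_prop
  have h' := congrArg (Measure.map fun (x : ℕ × ℕ → S) (l : ℕ) => x (i, l)) h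
  rw [Measure.map_map hrow (measurable_pi_lambda _ fun p => hξ _ _),
    Measure.map_map hrow (measurable_pi_lambda _ fun p => hξ _ _)] at h'
  rw [Measure.map_map (by unfold Function.comp; fun_prop)
    (measurable_pi_lambda _ fun p => hξ _ _)]
  exact h'

theorem RowExchangeable.map_row [IsProbabilityMeasure P]
    {ξ : ℕ → ℕ → Ω → S} (hex : RowExchangeable ξ P)
    (hξ : ∀ i j, Measurable (ξ i j)) (i : ℕ) :
    (P.map fun ω l => ξ i l ω) = P.map fun ω l => ξ 0 l ω := by
  have h := hex.map_eq hξ (isFinitePerm_swap 0 i) fun _ => isFinitePerm_one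
  have hrow : Measurable fun (x : ℕ × ℕ → S) (l : ℕ) => x (0, l) := by fun_prop
  have h' := congrArg (Measure.map fun (x : ℕ × ℕ → S) (l : ℕ) => x (0, l)) h
  rw [Measure.map_map hrow (measurable_pi_lambda _ fun p => hξ _ _),
    Measure.map_map hrow (measurable_pi_lambda _ fun p => hξ _ _)] at h'
  simpa [Function.comp_def] using h'

theorem RowExchangeable.map_rows_comp_swap [IsProbabilityMeasure P]
    {ξ : ℕ → ℕ → Ω → S} (hex : RowExchangeable ξ P)
    (hξ : ∀ i j, Measurable (ξ i j)) (j k : ℕ) :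
    (P.map fun ω i l => ξ i l ω).map (fun x => x ∘ Equiv.swap j k) = P.map fun ω i l => ξ i l ω := by
  have h := hex.map_eq hξ (isFinitePerm_swap j k) fun _ => isFinitePerm_one
  have hrow : Measurable fun (x : ℕ × ℕ → S) (i l : ℕ) => x (i, l) := by fun_prop
  have h' := congrArg (Measure.map fun (x : ℕ × ℕ → S) (i l : ℕ) => x (i, l)) h
  rw [Measure.map_map hrow (measurable_pi_lambda _ fun p => hξ _ _),
    Measure.map_map hrow (measurable_pi_lambda _ fun p => hξ _ _)] at h'
  rw [Measure.map_map (by unfold Function.comp; fun_prop)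
    (measurable_pi_lambda _ fun p => measurable_pi_lambda _ fun q => hξ _ _)]
  exact h'

theorem map_prodMk_eq_compProd_of_map {E U : Type*} [MeasurableSpace E] [MeasurableSpace U]
    {X : Ω → E} (hX : Measurable X) {G : E → U} (hG : Measurable G) {κ : Kernel U E}
    (h : (P.map X).map (fun x => (G x, x)) = (P.map X).map G ⊗ₘ κ) :
    P.map (fun ω => (G (X ω), X ω)) = P.map (fun ω => G (X ω)) ⊗ₘ κ := by
  have hG' : Measurable fun x => (G x, x) := hG.prodMk measurable_id
  rwa [Measure.map_map hG' hX, Measure.map_map hG hX] at h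

/-- Row distributions and a row distribution generator exist. -/
theorem RowExchangeable.exists_isRowDirecting [IsProbabilityMeasure P] [StandardBorelSpace S] [Nonempty S]
    {ξ : ℕ → ℕ → Ω → S} (hex : RowExchangeable ξ P) (hξ : ∀ i j, Measurable (ξ i j)) :
    ∃ (μ : ℕ → Ω → ProbabilityMeasure S) (ϖ : Ω → ProbabilityMeasure (ProbabilityMeasure S)),
      IsRowDirecting ξ μ ϖ P := by
  have hrow : ∀ i, Measurable fun ω l => ξ i l ω := fun i => measurable_pi_lambda _ fun l => hξ i l
  have hrows : Measurable fun ω i l => ξ i l ω := measurable_pi_lambda _ hrow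
  have := fun i => Measure.isProbabilityMeasure_map (μ := P) (hrow i).aemeasurable
  have := Measure.isProbabilityMeasure_map (μ := P) hrows.aemeasurable
  obtain ⟨G, hG, hGlaw⟩ := exists_directing_measure _ (hex.map_row_comp_swap hξ 0)
  obtain ⟨H, hH, hHlaw⟩ := exists_directing_measure _ (hex.map_rows_comp_swap hξ)
  let mapG : ProbabilityMeasure (ℕ → S) → ProbabilityMeasure (ProbabilityMeasure S) :=
    fun π => π.map hG.aemeasurable
  have hmapG : Measurable mapG :=
    Measurable.subtype_mk ((Measure.measurable_map G hG).comp measurable_subtype_coe)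
  refine ⟨fun i ω => G fun l => ξ i l ω, fun ω => mapG (H fun i l => ξ i l ω),
    fun i => hG.comp (hrow i), hmapG.comp (hH.comp hrows), ?_, fun i => ?_⟩
  · have h := map_prodMk_eq_compProd_of_map hrows hH hHlaw
    have hG' : Measurable fun (x : ℕ → ℕ → S) i => G (x i) := by fun_prop
    refine hasCondLaw_of_map_prodMk_eq_compProd (hmapG.comp (hH.comp hrows)) (hG'.comp hrows)
      (iidKernel (ProbabilityMeasure S))
      (map_prodMk_eq_compProd_comp (hH.comp hrows) hrows h hmapG hG' fun π => ?_)
    rw [iidKernel_apply, iidKernel_apply, Measure.infinitePi_map_pi _ fun _ => hG]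
    rfl
  · rw [← hex.map_row hξ i] at hGlaw
    exact hasCondLaw_of_map_prodMk_eq_compProd (hG.comp (hrow i)) (hrow i) (iidKernel S)
      (map_prodMk_eq_compProd_of_map (hrow i) hG hGlaw)

theorem HasCondLaw.condExp_iInter {X : Ω → ℕ → T} {Y : Ω → ProbabilityMeasure T}
    (h : HasCondLaw X Y (fun ω => Measure.infinitePi fun _ : ℕ => (Y ω : Measure T)) P)
    {B : Set T} (hB : MeasurableSet B) (F : Finset ℕ) :
    P⟦{ω | ∀ k ∈ F, X ω k ∈ B} | MeasurableSpace.comap Y inferInstance⟧ =ᵐ[P]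
      fun ω => (Y ω : Measure T).real B ^ F.card := by
  refine (h ((F : Set ℕ).pi fun _ => B) (.pi F.countable_toSet fun _ _ => hB)).trans
    (Filter.EventuallyEq.of_eq ?_)
  ext ω
  rw [measureReal_def, Measure.infinitePi_pi _ fun _ _ => hB, Finset.prod_const,
    ENNReal.toReal_pow]
  rfl

variable [IsProbabilityMeasure P]

open Filter Topology in
/-- The law of large numbers for mixtures of i.i.d. sequences. -/
theorem HasCondLaw.tendsto_eLpNorm_freq {X : Ω → ℕ → T} {Y : Ω → ProbabilityMeasure T}
    (hX : Measurable X) (hY : Measurable Y)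
    (h : HasCondLaw X Y (fun ω => Measure.infinitePi fun _ : ℕ => (Y ω : Measure T)) P)
    {B : Set T} (hB : MeasurableSet B) :
    Tendsto (fun N => eLpNorm (freq (fun k => {ω | X ω k ∈ B}) N -
      fun ω => (Y ω : Measure T).real B) 1 P) atTop (𝓝 0) := by
  set z : Ω → ℝ := fun ω => (Y ω : Measure T).real B with hz
  set s : ℕ → Set Ω := fun k => {ω | X ω k ∈ B} with hsdef
  have hs : ∀ k, MeasurableSet (s k) := fun k => (measurable_pi_apply k).comp hX hB
  have hreal : Measurable fun ν : ProbabilityMeasure T => (ν : Measure T).real B :=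
    ((Measure.measurable_coe hB).comp measurable_subtype_coe).ennreal_toReal
  have hzm : Measurable z := hreal.comp hY
  have hzY : StronglyMeasurable[MeasurableSpace.comap Y inferInstance] z :=
    (hreal.comp (comap_measurable Y)).stronglyMeasurable
  have hz1 : ∀ ω, ‖z ω‖ ≤ 1 := fun ω => by
    rw [Real.norm_of_nonneg measureReal_nonneg]; exact measureReal_le_one
  have h1 : ∀ k, P⟦s k | MeasurableSpace.comap Y inferInstance⟧ =ᵐ[P] z := by
    intro k
    have := h.condExp_iInter hB {k}
    simp only [Finset.mem_singleton, forall_eq, Finset.card_singleton, pow_one] at this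
    exact this
  have h2 : ∀ j k, j ≠ k →
      P⟦s j ∩ s k | MeasurableSpace.comap Y inferInstance⟧ =ᵐ[P] fun ω => z ω * z ω := by
    intro j k hjk
    have := h.condExp_iInter hB {j, k}
    rw [Finset.card_pair hjk] at this
    simp only [sq] at this
    refine EventuallyEq.trans (EventuallyEq.of_eq ?_) this
    congr 2
    ext ω
    simp [hsdef]
  have hP : ∀ A, MeasurableSet A →
      P.real A = ∫ ω, (P⟦A | MeasurableSpace.comap Y inferInstance⟧) ω ∂P := by
    intro A hA
    rw [integral_condExp hY.comap_le, integral_indicator_const _ hA]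
    simp
  refine _root_.tendsto_eLpNorm_freq hs (a := ∫ ω, z ω ∂P) (b := ∫ ω, z ω * z ω ∂P)
    (fun k => ?_) (fun j k hjk => ?_)
    (MemLp.of_bound hzm.aestronglyMeasurable 1 (Eventually.of_forall hz1)) (fun k => ?_) rfl
  · rw [hP _ (hs k), integral_congr_ae (h1 k)]
  · rw [hP _ ((hs j).inter (hs k)), integral_congr_ae (h2 j k hjk)]
  · have hint : Integrable ((s k).indicator fun _ => (1 : ℝ)) P :=
      (integrable_const _).indicator (hs k)
    have hzint : Integrable (z * (s k).indicator fun _ => (1 : ℝ)) P :=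
      hint.bdd_mul hzm.aestronglyMeasurable (Eventually.of_forall hz1)
    have h3 := condExp_mul_of_stronglyMeasurable_left hzY hzint hint
    have h4 : ∫ ω in s k, z ω ∂P = ∫ ω, (z * (s k).indicator fun _ => (1 : ℝ)) ω ∂P := by
      rw [← integral_indicator (hs k)]
      congr 1
      ext ω
      by_cases hω : ω ∈ s k <;> simp [hω]
    rw [h4, ← integral_condExp hY.comap_le]
    refine integral_congr_ae ?_
    filter_upwards [h3, h1 k] with ω h5 h6
    rw [h5, Pi.mul_apply, h6]

theorem measurable_probabilityMeasure_of_real {f : Ω → ProbabilityMeasure T}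
    (h : ∀ B, MeasurableSet B → Measurable fun ω => (f ω : Measure T).real B) : Measurable f := by
  refine Measurable.subtype_mk (f := fun ω => (f ω : Measure T))
    (Measure.measurable_of_measurable_coe _ fun B hB => ?_)
  simpa using (h B hB).ennreal_ofReal

theorem measurable_pi_probabilityMeasure {ι : Type*} [Fintype ι] :
    Measurable fun ν : ι → ProbabilityMeasure T => Measure.pi fun i => (ν i : Measure T) := by
  refine Measurable.measure_of_isPiSystem_of_isProbabilityMeasure
    generateFrom_pi.symm isPiSystem_pi ?_
  rintro _ ⟨t, ht, rfl⟩
  simp only [Set.mem_pi, Set.mem_univ, forall_const, Set.mem_ofPred_eq] at ht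
  simp_rw [Measure.pi_pi]
  exact Finset.measurable_prod _ fun i _ =>
    (Measure.measurable_coe (ht i)).comp (measurable_subtype_coe.comp (measurable_pi_apply i))

variable (S) in
/-- The law of a matrix with independent entries that are identically distributed within each row,
as a kernel in the row distributions. -/
noncomputable def blockKernel (m n : ℕ) :
    Kernel (Fin m → ProbabilityMeasure S) (Fin m → Fin n → S) where
  toFun ν := Measure.pi fun i => Measure.pi fun _ => (ν i : Measure S)
  measurable' := by
    have h : Measurable fun (ν : Fin m → ProbabilityMeasure S) (i : Fin m) =>
        (⟨Measure.pi fun _ : Fin n => (ν i : Measure S), inferInstance⟩ :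
          ProbabilityMeasure (Fin n → S)) :=
      measurable_pi_lambda _ fun i => Measurable.subtype_mk
        (measurable_pi_probabilityMeasure.comp
          (measurable_pi_lambda _ fun _ => measurable_pi_apply i))
    exact measurable_pi_probabilityMeasure.comp h

theorem blockKernel_apply (m n : ℕ) (ν : Fin m → ProbabilityMeasure S) :
    blockKernel S m n ν = Measure.pi fun i => Measure.pi fun _ => (ν i : Measure S) := rfl

instance (m n : ℕ) : IsMarkovKernel (blockKernel S m n) :=
  ⟨fun ν => by rw [blockKernel_apply]; infer_instance⟩

variable {ξ : ℕ → ℕ → Ω → S} {μ : ℕ → Ω → ProbabilityMeasure S}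
  {ϖ : Ω → ProbabilityMeasure (ProbabilityMeasure S)}

open Filter Topology in
theorem IsRowDirecting.tendsto_eLpNorm_freq (h : IsRowDirecting ξ μ ϖ P)
    (hξ : ∀ i j, Measurable (ξ i j)) (i : ℕ) {B : Set S} (hB : MeasurableSet B) :
    Tendsto (fun N => eLpNorm (freq (fun k => {ω | ξ i k ω ∈ B}) N -
      fun ω => (μ i ω : Measure S).real B) 1 P) atTop (𝓝 0) :=
  (h.entries_given_row i).tendsto_eLpNorm_freq (measurable_pi_lambda _ fun j => hξ i j)
    (h.measurable_row i) hB

theorem IsRowDirecting.measurable_symmetricEvents_row (h : IsRowDirecting ξ μ ϖ P)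
    (hξ : ∀ i j, Measurable (ξ i j)) (i : ℕ) :
    Measurable[symmetricEvents (fun ω (p : ℕ × ℕ) => ξ p.1 p.2 ω) P] (μ i) := by
  refine @measurable_probabilityMeasure_of_real _ _ (symmetricEvents _ P) _ _ fun B hB => ?_
  have hreal : Measurable fun ν : ProbabilityMeasure S => (ν : Measure S).real B :=
    ((Measure.measurable_coe hB).comp measurable_subtype_coe).ennreal_toReal
  exact measurable_symmetricEvents_of_tendsto_freq_row
    (measurable_pi_lambda _ fun p => hξ p.1 p.2) i hB (hreal.comp (h.measurable_row i))
    (h.tendsto_eLpNorm_freq hξ i hB)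

theorem IsRowDirecting.measurable_symmetricEvents_generator (h : IsRowDirecting ξ μ ϖ P)
    (hξ : ∀ i j, Measurable (ξ i j)) :
    Measurable[symmetricEvents (fun ω (p : ℕ × ℕ) => ξ p.1 p.2 ω) P] ϖ := by
  refine @measurable_probabilityMeasure_of_real _ _ (symmetricEvents _ P) _ _ fun C hC => ?_
  have hreal : Measurable fun ν : ProbabilityMeasure (ProbabilityMeasure S) =>
      (ν : Measure (ProbabilityMeasure S)).real C :=
    ((Measure.measurable_coe hC).comp measurable_subtype_coe).ennreal_toReal
  exact measurable_symmetricEvents_of_tendsto_freq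
    (fun k => h.measurable_symmetricEvents_row hξ k hC) (hreal.comp h.measurable_generator)
    (h.rows_given_generator.tendsto_eLpNorm_freq (measurable_pi_lambda _ h.measurable_row)
      h.measurable_generator hC)

theorem IsRowDirecting.condExp_block (h : IsRowDirecting ξ μ ϖ P) (hex : RowExchangeable ξ P)
    (hξ : ∀ i j, Measurable (ξ i j)) {m n : ℕ} {t : Fin m → Fin n → Set S}
    (ht : ∀ i j, MeasurableSet (t i j)) :
    P⟦block ξ m n ⁻¹' Set.univ.pi fun i => Set.univ.pi (t i) |
        symmetricEvents (fun ω (p : ℕ × ℕ) => ξ p.1 p.2 ω) P⟧ =ᵐ[P]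
      fun ω => (blockKernel S m n (firstTerms μ m ω)).real
        (Set.univ.pi fun i => Set.univ.pi (t i)) := by
  let B : ℕ × ℕ → Set S := fun p =>
    if h : p.1 < m ∧ p.2 < n then t ⟨p.1, h.1⟩ ⟨p.2, h.2⟩ else Set.univ
  have hB : ∀ p, MeasurableSet (B p) := by
    intro p
    simp only [B]
    split_ifs
    exacts [ht _ _, .univ]
  have hBt : ∀ (i : Fin m) (j : Fin n), B (i, j) = t i j := fun i j => by simp [B]
  have hreal : ∀ p, Measurable fun ν : ProbabilityMeasure S => (ν : Measure S).real (B p) :=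
    fun p => ((Measure.measurable_coe (hB p)).comp measurable_subtype_coe).ennreal_toReal
  have hZm : ∀ p : ℕ × ℕ, Measurable[symmetricEvents (fun ω (p : ℕ × ℕ) => ξ p.1 p.2 ω) P]
      fun ω => (μ p.1 ω : Measure S).real (B p) :=
    fun p => (hreal p).comp (h.measurable_symmetricEvents_row hξ p.1)
  have key := condExp_iInter_preimage (measurable_pi_lambda _ fun p => hξ p.1 p.2)
    (hex.rowSwapInvariant hξ) hB hZm
    (fun p => Integrable.of_bound (C := 1)
      ((hZm p).mono symmetricEvents_le le_rfl).aestronglyMeasurable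
      (Filter.Eventually.of_forall fun ω => by
        rw [Real.norm_of_nonneg measureReal_nonneg]; exact measureReal_le_one))
    (fun p => h.tendsto_eLpNorm_freq hξ p.1 (hB p))
    ((Finset.univ : Finset (Fin m × Fin n)).map
      (Fin.valEmbedding.prodMap Fin.valEmbedding))
  convert key using 2 with ω
  · congr 1
    ext ω
    simp only [Set.mem_preimage, Set.mem_pi, Set.mem_univ, forall_const, block, Finset.coe_map,
      Finset.coe_univ, Set.image_univ, Set.forall_mem_range, Prod.forall]
    exact forall₂_congr fun i j => by rw [← hBt]; rfl
  · rw [blockKernel_apply, measureReal_def, Measure.pi_pi]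
    simp_rw [Measure.pi_pi]
    rw [ENNReal.toReal_prod, Finset.prod_map, Fintype.prod_prod_type]
    simp [ENNReal.toReal_prod, hBt, firstTerms, measureReal_def]

theorem IsRowDirecting.map_prodMk_block {U : Type*} [MeasurableSpace U]
    (h : IsRowDirecting ξ μ ϖ P) (hex : RowExchangeable ξ P)
    (hξ : ∀ i j, Measurable (ξ i j)) {m n : ℕ} {Y : Ω → U}
    (hY : Measurable[symmetricEvents (fun ω (p : ℕ × ℕ) => ξ p.1 p.2 ω) P] Y)
    {f : U → Fin m → ProbabilityMeasure S} (hf : Measurable f)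
    (hfY : ∀ ω, f (Y ω) = firstTerms μ m ω) :
    P.map (fun ω => (Y ω, block ξ m n ω)) = P.map Y ⊗ₘ (blockKernel S m n).comap f hf := by
  have hblock : Measurable (block ξ m n) :=
    measurable_pi_lambda _ fun i => measurable_pi_lambda _ fun j => hξ i j
  refine map_prodMk_eq_compProd_of_condExp symmetricEvents_le hY hblock _
    (generateFrom_eq_pi (fun _ => generateFrom_pi) fun _ =>
      IsCountablySpanning.pi fun _ => isCountablySpanning_measurableSet).symm
    (IsPiSystem.pi fun _ => isPiSystem_pi) ?_
  rintro _ ⟨A, hA, rfl⟩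
  simp only [Set.mem_pi, Set.mem_univ, forall_const, Set.mem_image, Set.mem_ofPred_eq] at hA
  choose t ht hA using hA
  obtain rfl : A = fun i => Set.univ.pi (t i) := funext fun i => (hA i).symm
  simp only [Kernel.comap_apply, hfY]
  exact h.condExp_block hex hξ ht

theorem IsRowDirecting.condDistrib_block [StandardBorelSpace S] [Nonempty S] {U : Type*}
    [MeasurableSpace U] (h : IsRowDirecting ξ μ ϖ P) (hex : RowExchangeable ξ P)
    (hξ : ∀ i j, Measurable (ξ i j)) {m n : ℕ} {Y : Ω → U}
    (hY : Measurable[symmetricEvents (fun ω (p : ℕ × ℕ) => ξ p.1 p.2 ω) P] Y)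
    {f : U → Fin m → ProbabilityMeasure S} (hf : Measurable f)
    (hfY : ∀ ω, f (Y ω) = firstTerms μ m ω) :
    ∀ᵐ ω ∂P, condDistrib (block ξ m n) Y P (Y ω) =
      Measure.pi fun i : Fin m => Measure.pi fun _ : Fin n => (μ i ω : Measure S) := by
  have hblock : Measurable (block ξ m n) :=
    measurable_pi_lambda _ fun i => measurable_pi_lambda _ fun j => hξ i j
  have hY' : Measurable Y := hY.mono symmetricEvents_le le_rfl
  filter_upwards [ae_of_ae_map hY'.aemeasurable (condDistrib_ae_eq_of_measure_eq_compProd_of_measurable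
    hY' hblock (h.map_prodMk_block hex hξ hY hf hfY))] with ω hω
  rw [hω, Kernel.comap_apply, hfY, blockKernel_apply]
  rfl
end

theorem theorem3p3 {Ω S : Type*} [MeasurableSpace Ω] (P : Measure Ω) [IsProbabilityMeasure P]
    [TopologicalSpace S] [PolishSpace S] [MeasurableSpace S] [BorelSpace S] [Nonempty S]
    (ξ : ℕ → ℕ → Ω → S) (hξ : ∀ i j, Measurable (ξ i j)) (hex : RowExchangeable ξ P) :
    (∃ (μ : ℕ → Ω → ProbabilityMeasure S) (ϖ : Ω → ProbabilityMeasure (ProbabilityMeasure S)),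
      IsRowDirecting ξ μ ϖ P) ∧
    ∀ (μ : ℕ → Ω → ProbabilityMeasure S) (ϖ : Ω → ProbabilityMeasure (ProbabilityMeasure S)),
      IsRowDirecting ξ μ ϖ P → ∀ m n : ℕ, ∀ᵐ ω ∂P,
        condDistrib (block ξ m n) (fun ω' => (ϖ ω', firstTerms μ m ω')) P (ϖ ω, firstTerms μ m ω) =
            condDistrib (block ξ m n) (firstTerms μ m) P (firstTerms μ m ω) ∧
          condDistrib (block ξ m n) (firstTerms μ m) P (firstTerms μ m ω) =
            Measure.pi fun i : Fin m => Measure.pi fun _ : Fin n => (μ i ω : Measure S) := by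
  refine ⟨hex.exists_isRowDirecting hξ, fun μ ϖ h m n => ?_⟩
  have hfirst : Measurable[symmetricEvents (fun ω (p : ℕ × ℕ) => ξ p.1 p.2 ω) P]
      (firstTerms μ m) :=
    @measurable_pi_lambda _ _ _ (symmetricEvents _ P) _ _ fun i =>
      h.measurable_symmetricEvents_row hξ i
  filter_upwards [h.condDistrib_block hex hξ (n := n)
      ((h.measurable_symmetricEvents_generator hξ).prodMk hfirst) measurable_snd fun _ => rfl,
    h.condDistrib_block hex hξ (n := n) hfirst measurable_id fun _ => rfl] with ω h1 h2
  exact ⟨h1.trans h2.symm, h2⟩
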